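/- Let $n\ge 2$ and $E_n^2=\{0,1,\dots,n-1\}^2$. A function $f:E_n^2\to\{0,1\}$ is called $k$-threshold if the set $M_1(f)=\{x: f(x)=1\}$ is the set of all $x\in E_n^2$ that satisfy some system of $k$ linear inequalities $a_{i1}x_1+a_{i2}x_2\le a_{i0}$ $(i=1,\dots,k)$ with real coefficients. Let $\mathfrak T(2,n,k)$ be the class of these functions and $\mathfrak T(2,n)=\mathfrak T(2,n,1)$ the class of threshold functions; put $M_0(f)=E_n^2\setminus M_1(f)$. A set $\{f_1,f_2\}\subseteq\mathfrak T(2,n)$ (where $f_1=f_2$ is allowed) is a defining set of $f$ if $f=f_1\wedge f_2$. For $g\in\mathfrak T(2,n)$ let $S(g)$ be the set of its essential points with respect to $\mathfrak T(2,n)$, that is, of all $x\in E_n^2$ for which some $h\in\mathfrak T(2,n)$ differs from $g$ at $x$ and at no other point. A teaching set of $f\in\mathfrak T(2,n,2)$ with respect to $\mathfrak T(2,n,2)$ is a set $T\subseteq E_n^2$ such that no function in $\mathfrak T(2,n,2)$ other than $f$ agrees with $f$ on $T$; let $\sigma(f,\mathfrak T(2,n,2))$ be the minimum cardinality of such a set.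 Let $B$ be the set of points of $E_n^2$ that lie on the boundary of the square $\mathrm{Conv}(E_n^2)$. **Theorem.** Let $f\in\mathfrak T(2,n,2)$ with $M_1(f)\cap B\neq\emptyset$, and suppose that some defining set $\{f_1,f_2\}$ of $f$ satisfies $$S(f_1)\cap M_0(f_2)=\emptyset,\qquad S(f_2)\cap M_0(f_1)=\emptyset .$$ Then $\{f_1,f_2\}$ is the unique defining set of $f$, and $\sigma(f,\mathfrak T(2,n,2))\le 9$. Moreover, for every $x'\in M_1(f)\cap B$ the set $S(f_1)\cup S(f_2)\cup\{x'\}$ is a teaching set of $f$ with respect to $\mathfrak T(2,n,2)$ and has at most $9$ elements. -/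

import Mathlib

/-- The integer cube `E_n^d = {0, 1, …, n-1}^d`. -/
abbrev Cube (d n : ℕ) : Type := Fin d → Fin n

/-- A point of the cube, as a point of `ℝ^d`. -/
def Cube.toReal {d n : ℕ} (x : Cube d n) : Fin d → ℝ := fun j => ((x j : ℕ) : ℝ)

/-- `M_ν(f)`: the points at which `f` takes the value `ν` (`true` is `1`, `false` is `0`). -/
def levelSet {X : Type*} (ν : Bool) (f : X → Bool) : Set X := {x | f x = ν}

/-- The class `𝔗(d, n, k)` of `k`-threshold functions over `E_n^d`: those whose `1`-points are the
solutions in the cube of a system of `k` linear inequalities with real coefficients. -/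
def kThreshold (d n k : ℕ) : Set (Cube d n → Bool) :=
  {f | ∃ (a : Fin k → Fin d → ℝ) (a₀ : Fin k → ℝ),
    levelSet true f = {x | ∀ i, ∑ j, a i j * x.toReal j ≤ a₀ i}}

/-- The class `𝔗(d, n)` of threshold functions over `E_n^d`. -/
def threshold (d n : ℕ) : Set (Cube d n → Bool) :=
  {f | ∃ (a : Fin d → ℝ) (a₀ : ℝ),
    levelSet true f = {x | ∑ j, a j * x.toReal j ≤ a₀}}

/-- `F = {f_1, …, f_k}` is a set of threshold functions with `f = f_1 ∧ ⋯ ∧ f_k`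
(the `f_i` need not be distinct). -/
def IsDefiningSet {d n : ℕ} (k : ℕ) (F : Set (Cube d n → Bool)) (f : Cube d n → Bool) : Prop :=
  ∃ g : Fin k → (Cube d n → Bool),
    (∀ i, g i ∈ threshold d n) ∧ Set.range g = F ∧ ∀ x, f x = true ↔ ∀ i, g i x = true

/-- The set `S(f, C)` of essential points of `f` with respect to the class `C`. -/
def essentialPoints {X : Type*} (C : Set (X → Bool)) (f : X → Bool) : Set X :=
  {x | ∃ g ∈ C, f x ≠ g x ∧ ∀ y, y ≠ x → f y = g y}

/-- `T` is a teaching set of `f` with respect to `C`: no function of `C` other than `f` agrees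
with `f` on `T`. -/
def IsTeachingSet {X : Type*} (C : Set (X → Bool)) (f : X → Bool) (T : Set X) : Prop :=
  ∀ g ∈ C, (∀ x ∈ T, g x = f x) → g = f

/-- `σ(f, C)`: the minimum cardinality of a teaching set of `f` with respect to `C`. -/
noncomputable def teachingNumber {X : Type*} (C : Set (X → Bool)) (f : X → Bool) : ℕ∞ :=
  ⨅ (T : Set X) (_ : IsTeachingSet C f T), T.encard

/-- `B(Conv(E_n^d))`: the points of the cube on the topological boundary of its convex hull. -/
def cubeBorder (d n : ℕ) : Set (Cube d n) :=
  {x | x.toReal ∈ frontier (convexHull ℝ (Set.range (Cube.toReal : Cube d n → Fin d → ℝ)))}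

/-! Let `g = g₁ ∧ g₂` agree with `f` on S(f₁) ∪ S(f₂) ∪ {x'}. The essential points of a threshold
function form a teaching set for it (`isTeachingSet_essentialPoints`), and by hypothesis `f`
coincides with `f₁` on S(f₁) and with `f₂` on S(f₂). Hence if `g₁ ≠ f₁`, some zero of `f₁` in S(f₁)
is a 1-point of `g₁` and so a zero of `g₂`; the same holds for each of the four pairs made of one
`fᵢ` and one `gⱼ`. The hypotheses on S(f₁) and S(f₂) then leave two possibilities: either {g₁, g₂} =
{f₁, f₂}, or all four such points exist.

In the second case the four points form a cycle around x' in which `f₁`, `g₂`, `f₂`, `g₁` each cut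
off two consecutive points from x' and the other two. If x' is on the border, all points lie in a
half plane bounded by a line through x', and such a cycle is impossible (`not_cyclic_cuts`). Applied
to an arbitrary defining pair, the same argument gives uniqueness.

The bound 9 = 4 + 4 + 1 rests on `encard_essentialPoints_le`: a planar threshold function has at
most four essential points. A nonconstant one has at most two essential zeros and, by negation, at
most two essential 1-points; for a constant one only the corners of the square can be essential. -/

/-! ### Threshold functions as sign patterns of affine functions -/

/-- The restrictions of real affine functions to the cube. -/
def affineFunctions (d n : ℕ) : Submodule ℝ (Cube d n → ℝ) where
  carrier := {φ | ∃ (a : Fin d → ℝ) (c : ℝ), ∀ x, φ x = c + ∑ j, a j * x.toReal j}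
  add_mem' := by
    rintro φ ψ ⟨a, c, h⟩ ⟨a', c', h'⟩
    refine ⟨a + a', c + c', fun x => ?_⟩
    simp only [Pi.add_apply, h, h', add_mul, Finset.sum_add_distrib]
    ring
  zero_mem' := ⟨0, 0, fun x => by simp⟩
  smul_mem' := by
    rintro r φ ⟨a, c, h⟩
    refine ⟨r • a, r * c, fun x => ?_⟩
    simp only [Pi.smul_apply, smul_eq_mul, h, mul_add, Finset.mul_sum, mul_assoc]

/-- `φ` is positive at the `1`-points of `g` and negative at its `0`-points. -/
def Represents {X : Type*} (φ : X → ℝ) (g : X → Bool) : Prop :=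
  ∀ x, (g x = true → 0 < φ x) ∧ (g x = false → φ x < 0)

theorem mem_threshold_of_nonneg {d n : ℕ} {φ : Cube d n → ℝ} (hφ : φ ∈ affineFunctions d n)
    {g : Cube d n → Bool} (h : ∀ x, g x = true ↔ 0 ≤ φ x) : g ∈ threshold d n := by
  obtain ⟨a, c, hac⟩ := hφ
  refine ⟨-a, c, ?_⟩
  ext x
  simp only [levelSet, Set.mem_ofPred_eq, h, hac, Pi.neg_apply, neg_mul, Finset.sum_neg_distrib]
  constructor <;> intro h <;> linarith

/-- The cube is finite, so the bound `a₀` can be raised slightly without admitting any new point;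
this makes both inequalities strict. -/
theorem mem_threshold_iff {d n : ℕ} {g : Cube d n → Bool} :
    g ∈ threshold d n ↔ ∃ φ ∈ affineFunctions d n, Represents φ g := by
  constructor
  · rintro ⟨a, a₀, h⟩
    have key : ∀ x, g x = true ↔ ∑ j, a j * x.toReal j ≤ a₀ := fun x => by
      have := Set.ext_iff.1 h x
      simpa [levelSet] using this
    have hev : ∀ᶠ c in nhdsWithin a₀ (Set.Ioi a₀),
        ∀ x : Cube d n, g x = false → c < ∑ j, a j * x.toReal j := by
      refine Filter.eventually_all.2 fun x => ?_
      by_cases hx : g x = false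
      · have : a₀ < ∑ j, a j * x.toReal j := by
          by_contra hlt
          rw [(key x).2 (not_lt.1 hlt)] at hx
          cases hx
        filter_upwards [eventually_nhdsWithin_of_eventually_nhds (eventually_lt_nhds this)]
          with c hc _ using hc
      · exact Filter.Eventually.of_forall fun c h => absurd h hx
    obtain ⟨c, hc, hc₀⟩ := (hev.and self_mem_nhdsWithin).exists
    refine ⟨fun x => c + ∑ j, (-a) j * x.toReal j, ⟨-a, c, fun x => rfl⟩, fun x => ?_⟩
    simp only [Pi.neg_apply, neg_mul, Finset.sum_neg_distrib]
    refine ⟨fun hx => ?_, fun hx => ?_⟩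
    · have := (key x).1 hx
      have : a₀ < c := hc₀
      linarith
    · have := hc x hx
      linarith
  · rintro ⟨φ, hφ, h⟩
    refine mem_threshold_of_nonneg hφ fun x => ⟨fun hx => ((h x).1 hx).le, fun hx => ?_⟩
    by_contra hg
    exact absurd ((h x).2 (by simpa using hg)) (by linarith)

theorem not_mem_threshold {d n : ℕ} {g : Cube d n → Bool} (hg : g ∈ threshold d n) :
    (fun x => !g x) ∈ threshold d n := by
  obtain ⟨φ, hφ, h⟩ := mem_threshold_iff.1 hg
  refine mem_threshold_iff.2 ⟨-φ, neg_mem hφ, fun x => ⟨fun hx => ?_, fun hx => ?_⟩⟩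
  · have := (h x).2 (by simpa using hx)
    simpa using this
  · have := (h x).1 (by simpa using hx)
    simpa using this

theorem essentialPoints_not {d n : ℕ} (g : Cube d n → Bool) :
    essentialPoints (threshold d n) (fun x => !g x) = essentialPoints (threshold d n) g := by
  ext x
  constructor
  · rintro ⟨h, hh, hne, heq⟩
    refine ⟨_, not_mem_threshold hh, fun h' => hne ?_, fun y hy => ?_⟩
    · simp [h']
    · simp [← heq y hy]
  · rintro ⟨h, hh, hne, heq⟩
    refine ⟨_, not_mem_threshold hh, fun h' => hne ?_, fun y hy => ?_⟩
    · simpa using h'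
    · simp [heq y hy]

theorem exists_affine_separating {d n : ℕ} {x y : Cube d n} (hxy : x ≠ y) :
    ∃ φ ∈ affineFunctions d n, φ x = 0 ∧ φ y ≠ 0 := by
  obtain ⟨i, hi⟩ := Function.ne_iff.1 hxy
  refine ⟨fun w => w.toReal i - x.toReal i,
    ⟨Pi.single i 1, -x.toReal i, fun w => ?_⟩, by simp, ?_⟩
  · simp [Pi.single_apply]
    ring
  · intro h
    apply hi
    have : y.toReal i = x.toReal i := by linarith
    simp only [Cube.toReal, Nat.cast_inj] at this
    exact (Fin.ext this).symm

/-! ### Essential points determine a threshold function -/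

/-- Representing `g` is an open condition, so `A` may be perturbed by a small multiple of an affine
function that vanishes at `x` but not at `y`. -/
theorem exists_represents_ratio_ne {d n : ℕ} {g : Cube d n → Bool} {A B : Cube d n → ℝ}
    (hA : A ∈ affineFunctions d n) (hgA : Represents A g) {x y : Cube d n} (hxy : x ≠ y)
    (hx : B x ≠ 0) :
    ∃ A' ∈ affineFunctions d n, Represents A' g ∧ A' x * B y ≠ A' y * B x := by
  by_cases h : A x * B y = A y * B x
  · obtain ⟨M, hM, hMx, hMy⟩ := exists_affine_separating hxy
    have hev : ∀ᶠ ε in nhdsWithin (0 : ℝ) (Set.Ioi 0), Represents (A + ε • M) g := by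
      refine Filter.eventually_all.2 fun w => eventually_nhdsWithin_of_eventually_nhds ?_
      have hc : Filter.Tendsto (fun ε : ℝ => (A + ε • M) w) (nhds 0) (nhds (A w)) := by
        have : Continuous fun ε : ℝ => (A + ε • M) w := by
          simp only [Pi.add_apply, Pi.smul_apply, smul_eq_mul]
          fun_prop
        simpa using this.tendsto 0
      cases hw : g w
      · filter_upwards [hc.eventually_lt_const ((hgA w).2 hw)] with ε hε
        exact ⟨by simp, fun _ => hε⟩
      · filter_upwards [hc.eventually_const_lt ((hgA w).1 hw)] with ε hε
        exact ⟨fun _ => hε, by simp⟩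
    obtain ⟨ε, hε, hε₀⟩ := (hev.and self_mem_nhdsWithin).exists
    refine ⟨_, add_mem hA (Submodule.smul_mem _ ε hM), hε, ?_⟩
    simp only [Pi.add_apply, Pi.smul_apply, smul_eq_mul, hMx, mul_zero, add_zero, add_mul, h]
    intro h'
    have : ε * M y * B x = 0 := by linarith
    have hε₀ : ε ≠ 0 := ne_of_gt hε₀
    exact mul_ne_zero (mul_ne_zero hε₀ hMy) hx this
  · exact ⟨A, hA, hgA, h⟩

/-- As `r` grows from 0, the sign pattern of `A + r B` moves from `g` to `h`; a point `w` of
disagreement flips at `r = -A w / B w` and the other points never flip. An `r` between the two flip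
times gives `h'`. -/
theorem exists_threshold_between {d n : ℕ} {g h : Cube d n → Bool} {A B : Cube d n → ℝ}
    (hA : A ∈ affineFunctions d n) (hB : B ∈ affineFunctions d n) (hgA : Represents A g)
    (hhB : Represents B h) {x y : Cube d n} (hx : h x ≠ g x) (hy : h y ≠ g y)
    (hlt : -A x / B x < -A y / B y) :
    ∃ h' ∈ threshold d n, h' x ≠ g x ∧ h' y = g y ∧ ∀ w, h w = g w → h' w = g w := by
  have hpos : ∀ w, h w ≠ g w → 0 < -A w / B w := by
    intro w hw
    cases hgw : g w
    · have h1 := (hgA w).2 hgw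
      have h2 := (hhB w).1 (by simpa [hgw] using hw)
      exact div_pos (by linarith) h2
    · have h1 := (hgA w).1 hgw
      have h2 := (hhB w).2 (by simpa [hgw] using hw)
      exact div_pos_of_neg_of_neg (by linarith) h2
  obtain ⟨r, hr1, hr2⟩ := exists_between hlt
  have hr : 0 < r := (hpos x hx).trans hr1
  refine ⟨fun w => decide (0 ≤ A w + r * B w),
    mem_threshold_of_nonneg (add_mem hA (Submodule.smul_mem _ r hB)) (fun w => by simp),
    ?_, ?_, ?_⟩
  · cases hgx : g x
    · have h2 := (hhB x).1 (by simpa [hgx] using hx)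
      rw [div_lt_iff₀ h2] at hr1
      simp only [ne_eq, decide_eq_false_iff_not, not_not]
      linarith
    · have h2 := (hhB x).2 (by simpa [hgx] using hx)
      rw [div_lt_iff_of_neg h2] at hr1
      simp only [ne_eq, decide_eq_true_eq, not_le]
      linarith
  · cases hgy : g y
    · have h2 := (hhB y).1 (by simpa [hgy] using hy)
      rw [lt_div_iff₀ h2] at hr2
      simp only [decide_eq_false_iff_not, not_le]
      linarith
    · have h2 := (hhB y).2 (by simpa [hgy] using hy)
      rw [lt_div_iff_of_neg h2] at hr2
      simp only [decide_eq_true_eq]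
      linarith
  · intro w hw
    cases hgw : g w
    · have h1 := (hgA w).2 hgw
      have h2 := (hhB w).2 (hw.trans hgw)
      simp only [decide_eq_false_iff_not, not_le]
      nlinarith
    · have h1 := (hgA w).1 hgw
      have h2 := (hhB w).1 (hw.trans hgw)
      simp only [decide_eq_true_eq]
      positivity

/-- Induction on the number of disagreements: a single one would be essential, and from two or more
an intermediate threshold function has fewer, but still at least one. -/
theorem isTeachingSet_essentialPoints {d n : ℕ} {g : Cube d n → Bool} (hg : g ∈ threshold d n) :
    IsTeachingSet (threshold d n) g (essentialPoints (threshold d n) g) := by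
  obtain ⟨A₀, hA₀, hgA₀⟩ := mem_threshold_iff.1 hg
  suffices H : ∀ (k : ℕ) (h : Cube d n → Bool), h ∈ threshold d n →
      {x | h x ≠ g x}.ncard = k → (∀ x ∈ essentialPoints (threshold d n) g, h x = g x) →
      h = g from fun h hh hS => H _ h hh rfl hS
  intro k
  induction k using Nat.strong_induction_on with
  | _ k ih =>
    intro h hh hk hS
    by_contra hne
    obtain ⟨x, hx⟩ := Function.ne_iff.1 hne
    obtain ⟨y, hyx, hy⟩ : ∃ y, y ≠ x ∧ h y ≠ g y := by
      by_contra hcon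
      push Not at hcon
      exact hx (hS x ⟨h, hh, fun e => hx e.symm, fun y hy => (hcon y hy).symm⟩)
    obtain ⟨B, hB, hhB⟩ := mem_threshold_iff.1 hh
    have hB0 : ∀ w, B w ≠ 0 := fun w => by
      cases hw : h w
      · exact ((hhB w).2 hw).ne
      · exact ((hhB w).1 hw).ne'
    obtain ⟨A, hA, hgA, hAB⟩ := exists_represents_ratio_ne hA₀ hgA₀ hyx.symm (hB0 x)
    have main : ∀ x y, h x ≠ g x → h y ≠ g y → -A x / B x < -A y / B y → False := by
      intro x y hx hy hlt
      obtain ⟨h', hh', hx', hy', hsub⟩ := exists_threshold_between hA hB hgA hhB hx hy hlt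
      refine hx' (congrFun (ih _ ?_ h' hh' rfl fun w hw => hsub w (hS w hw)) x)
      rw [← hk]
      refine Set.ncard_lt_ncard ⟨fun w hw => fun e => hw (hsub w e), fun hs => ?_⟩ (Set.toFinite _)
      exact hs hy hy'
    rcases lt_trichotomy (-A x / B x) (-A y / B y) with hlt | heq | hlt
    · exact main x y hx hy hlt
    · rw [div_eq_div_iff (hB0 x) (hB0 y)] at heq
      exact hAB (by linarith)
    · exact main y x hy hx hlt

/-! ### At most four essential points in the plane -/

/-- The origin lies strictly inside the triangle with vertices `u`, `v`, `s`. -/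
def EnclosesZero (u₁ u₂ v₁ v₂ s₁ s₂ : ℤ) : Prop :=
  ∃ l m d : ℤ, 0 < l ∧ 0 < m ∧ 0 < d ∧ l * u₁ + m * v₁ + d * s₁ = 0 ∧
    l * u₂ + m * v₂ + d * s₂ = 0

theorem EnclosesZero.reflect_fst {u₁ u₂ v₁ v₂ s₁ s₂ : ℤ} (h : EnclosesZero u₁ u₂ v₁ v₂ s₁ s₂) :
    EnclosesZero (-u₁) u₂ (-v₁) v₂ (-s₁) s₂ := by
  obtain ⟨l, m, d, hl, hm, hd, h1, h2⟩ := h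
  exact ⟨l, m, d, hl, hm, hd, by linarith, h2⟩

theorem EnclosesZero.transpose {u₁ u₂ v₁ v₂ s₁ s₂ : ℤ} (h : EnclosesZero u₁ u₂ v₁ v₂ s₁ s₂) :
    EnclosesZero u₂ u₁ v₂ v₁ s₂ s₁ := by
  obtain ⟨l, m, d, hl, hm, hd, h1, h2⟩ := h
  exact ⟨l, m, d, hl, hm, hd, h2, h1⟩

theorem EnclosesZero.swap {u₁ u₂ v₁ v₂ s₁ s₂ : ℤ} (h : EnclosesZero u₁ u₂ v₁ v₂ s₁ s₂) :
    EnclosesZero v₁ v₂ u₁ u₂ s₁ s₂ := by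
  obtain ⟨l, m, d, hl, hm, hd, h1, h2⟩ := h
  exact ⟨m, l, d, hm, hl, hd, by linarith, by linarith⟩

/-- A nonzero integer vector `s` such that `s` and `-s` lie in the box `[-a, b] × [-c, e]` and
neither lies in the open cone opposite to the one spanned by `u` and `v`. -/
def HasSymmetricPair (a b c e u₁ u₂ v₁ v₂ : ℤ) : Prop :=
  ∃ s₁ s₂ : ℤ, (s₁ ≠ 0 ∨ s₂ ≠ 0) ∧ (-a ≤ s₁ ∧ s₁ ≤ b ∧ -b ≤ s₁ ∧ s₁ ≤ a) ∧
    (-c ≤ s₂ ∧ s₂ ≤ e ∧ -e ≤ s₂ ∧ s₂ ≤ c) ∧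
    ¬ EnclosesZero u₁ u₂ v₁ v₂ s₁ s₂ ∧ ¬ EnclosesZero u₁ u₂ v₁ v₂ (-s₁) (-s₂)

theorem HasSymmetricPair.reflect_fst {a b c e u₁ u₂ v₁ v₂ : ℤ}
    (h : HasSymmetricPair b a c e (-u₁) u₂ (-v₁) v₂) : HasSymmetricPair a b c e u₁ u₂ v₁ v₂ := by
  obtain ⟨s₁, s₂, hs, ⟨h1, h2, h3, h4⟩, h5, h6, h7⟩ := h
  refine ⟨-s₁, s₂, by simpa using hs, ⟨by linarith, by linarith, by linarith, by linarith⟩, h5,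
    fun h => h6 (by simpa using h.reflect_fst), fun h => h7 (by simpa using h.reflect_fst)⟩

theorem HasSymmetricPair.transpose {a b c e u₁ u₂ v₁ v₂ : ℤ}
    (h : HasSymmetricPair c e a b u₂ u₁ v₂ v₁) : HasSymmetricPair a b c e u₁ u₂ v₁ v₂ := by
  obtain ⟨s₁, s₂, hs, h1, h2, h3, h4⟩ := h
  exact ⟨s₂, s₁, hs.symm, h2, h1, fun h => h3 h.transpose, fun h => h4 h.transpose⟩

theorem HasSymmetricPair.swap {a b c e u₁ u₂ v₁ v₂ : ℤ}
    (h : HasSymmetricPair a b c e v₁ v₂ u₁ u₂) : HasSymmetricPair a b c e u₁ u₂ v₁ v₂ := by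
  obtain ⟨s₁, s₂, hs, h1, h2, h3, h4⟩ := h
  exact ⟨s₁, s₂, hs, h1, h2, fun h => h3 h.swap, fun h => h4 h.swap⟩

theorem HasSymmetricPair.reflect_snd {a b c e u₁ u₂ v₁ v₂ : ℤ}
    (h : HasSymmetricPair a b e c u₁ (-u₂) v₁ (-v₂)) : HasSymmetricPair a b c e u₁ u₂ v₁ v₂ :=
  h.transpose.reflect_fst.transpose

/-- Otherwise the vanishing positive combination forces `u₂ = v₂ = 0`, making `u` and `v` parallel.
-/
theorem EnclosesZero.pos_or_pos {u₁ u₂ v₁ v₂ p₁ p₂ : ℤ} (h : EnclosesZero u₁ u₂ v₁ v₂ p₁ p₂)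
    (hD : u₁ * v₂ ≠ u₂ * v₁) : 0 < u₂ ∨ 0 < v₂ ∨ 0 < p₂ := by
  obtain ⟨l, m, d, hl, hm, hd, h1, h2⟩ := h
  by_contra hcon
  push Not at hcon
  obtain ⟨hu, hv, hp⟩ := hcon
  have h3 := mul_nonpos_of_nonneg_of_nonpos hl.le hu
  have h4 := mul_nonpos_of_nonneg_of_nonpos hm.le hv
  have h5 := mul_nonpos_of_nonneg_of_nonpos hd.le hp
  have hu0 : u₂ = 0 := by
    rcases mul_eq_zero.1 (by linarith : l * u₂ = 0) with h | h <;> omega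
  have hv0 : v₂ = 0 := by
    rcases mul_eq_zero.1 (by linarith : m * v₂ = 0) with h | h <;> omega
  simp [hu0, hv0] at hD

/-- If `u` and `v` lie in an open half plane bounded by the line of direction `(0, 1)`, then
`(0, 1)` is a symmetric pair, as long as it fits into the box. -/
theorem hasSymmetricPair_of_neg {a b c e u₁ u₂ v₁ v₂ p₁ p₂ : ℤ} (ha : 0 ≤ a) (hb : 0 ≤ b)
    (hu₂ : -c ≤ u₂ ∧ u₂ ≤ e) (hv₂ : -c ≤ v₂ ∧ v₂ ≤ e) (hp₂ : -c ≤ p₂ ∧ p₂ ≤ e)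
    (hp : EnclosesZero u₁ u₂ v₁ v₂ p₁ p₂) (hD : u₁ * v₂ ≠ u₂ * v₁)
    (hu : u₁ < 0) (hv : v₁ ≤ 0) : HasSymmetricPair a b c e u₁ u₂ v₁ v₂ := by
  have he : 0 < e := by
    rcases hp.pos_or_pos hD with h | h | h <;> omega
  have hc : 0 < c := by
    have : EnclosesZero u₁ (-u₂) v₁ (-v₂) p₁ (-p₂) := hp.transpose.reflect_fst.transpose
    rcases this.pos_or_pos (by intro h; apply hD; linarith) with h | h | h <;> omega
  refine ⟨0, 1, by simp, ⟨by omega, by omega, by omega, by omega⟩,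
    ⟨by omega, by omega, by omega, by omega⟩, ?_, ?_⟩ <;>
  · rintro ⟨l, m, d, hl, hm, hd, h1, h2⟩
    have h3 := mul_neg_of_pos_of_neg hl hu
    have h4 := mul_nonpos_of_nonneg_of_nonpos hm.le hv
    simp at h1
    linarith

/-- Here `-u` and `-v` leave the box through adjacent sides. A coordinate vector works unless `v₁`
and `u₂` are both positive. -/
theorem hasSymmetricPair_of_crossed {a b c e u₁ u₂ v₁ v₂ p₁ p₂ : ℤ}
    (ha : 0 ≤ a) (hb : 0 ≤ b) (hc : 0 ≤ c) (he : 0 ≤ e)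
    (hu₁ : -a ≤ u₁ ∧ u₁ ≤ b) (hv₁ : -a ≤ v₁ ∧ v₁ ≤ b) (hp₁ : -a ≤ p₁ ∧ p₁ ≤ b)
    (hu₂ : -c ≤ u₂ ∧ u₂ ≤ e) (hv₂ : -c ≤ v₂ ∧ v₂ ≤ e) (hp₂ : -c ≤ p₂ ∧ p₂ ≤ e)
    (hp : EnclosesZero u₁ u₂ v₁ v₂ p₁ p₂) (hD : u₁ * v₂ ≠ u₂ * v₁)
    (hu : u₁ < -b) (hv : v₂ < -e) : HasSymmetricPair a b c e u₁ u₂ v₁ v₂ := by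
  rcases le_or_gt v₁ 0 with hv0 | hv0
  · exact hasSymmetricPair_of_neg ha hb hu₂ hv₂ hp₂ hp hD (by omega) hv0
  rcases le_or_gt u₂ 0 with hu0 | hu0
  · exact (hasSymmetricPair_of_neg hc he hv₁ hu₁ hp₁ hp.transpose.swap
      (fun h => hD (by linarith)) (by omega) hu0).swap.transpose
  -- This vector and its opposite fit since `v₁ ≤ b < -u₁ ≤ a` and `u₂ ≤ e < -v₂ ≤ c`.
  refine ⟨v₁, -u₂, by omega, ⟨by omega, by omega, by omega, by omega⟩,
    ⟨by omega, by omega, by omega, by omega⟩, ?_, ?_⟩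
  · rintro ⟨l, m, d, hl, hm, hd, h1, h2⟩
    have h3 : l * v₁ < l * (-u₁) := mul_lt_mul_of_pos_left (by omega) hl
    have h4 : m * u₂ < m * (-v₂) := mul_lt_mul_of_pos_left (by omega) hm
    have h5 : l < m + d := lt_of_mul_lt_mul_right (by linarith : l * v₁ < (m + d) * v₁) hv0.le
    have h6 : m < l - d := lt_of_mul_lt_mul_right (by linarith : m * u₂ < (l - d) * u₂) hu0.le
    linarith
  · rintro ⟨l, m, d, hl, hm, hd, h1, h2⟩
    have h3 : l * v₁ < l * (-u₁) := mul_lt_mul_of_pos_left (by omega) hl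
    have h4 : m * u₂ < m * (-v₂) := mul_lt_mul_of_pos_left (by omega) hm
    have h5 : l < m - d := lt_of_mul_lt_mul_right (by linarith : l * v₁ < (m - d) * v₁) hv0.le
    have h6 : m < l + d := lt_of_mul_lt_mul_right (by linarith : m * u₂ < (l + d) * u₂) hu0.le
    linarith

/-- If `-u` also fits into the box, `u` itself serves: `u` and `-u` lie on the line spanned by `u`,
which misses the open cone. -/
theorem hasSymmetricPair_of_neg_mem {a b c e u₁ u₂ v₁ v₂ : ℤ}
    (hu₁ : -a ≤ u₁ ∧ u₁ ≤ b) (hu₂ : -c ≤ u₂ ∧ u₂ ≤ e) (hD : u₁ * v₂ ≠ u₂ * v₁)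
    (h₁ : -b ≤ u₁ ∧ u₁ ≤ a) (h₂ : -e ≤ u₂ ∧ u₂ ≤ c) :
    HasSymmetricPair a b c e u₁ u₂ v₁ v₂ := by
  refine ⟨u₁, u₂, ?_, ⟨hu₁.1, hu₁.2, h₁.1, h₁.2⟩, ⟨hu₂.1, hu₂.2, h₂.1, h₂.2⟩, ?_, ?_⟩
  · by_contra h
    push Not at h
    simp [h.1, h.2] at hD
  · rintro ⟨l, m, d, hl, hm, hd, h1, h2⟩
    have : m * (u₁ * v₂ - u₂ * v₁) = 0 := by linear_combination u₁ * h2 - u₂ * h1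
    rcases mul_eq_zero.1 this with h | h
    · omega
    · exact hD (by linarith)
  · rintro ⟨l, m, d, hl, hm, hd, h1, h2⟩
    have : m * (u₁ * v₂ - u₂ * v₁) = 0 := by linear_combination u₁ * h2 - u₂ * h1
    rcases mul_eq_zero.1 this with h | h
    · omega
    · exact hD (by linarith)

theorem hasSymmetricPair_of_enclosesZero {a b c e u₁ u₂ v₁ v₂ p₁ p₂ : ℤ}
    (ha : 0 ≤ a) (hb : 0 ≤ b) (hc : 0 ≤ c) (he : 0 ≤ e)
    (hu₁ : -a ≤ u₁ ∧ u₁ ≤ b) (hv₁ : -a ≤ v₁ ∧ v₁ ≤ b) (hp₁ : -a ≤ p₁ ∧ p₁ ≤ b)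
    (hu₂ : -c ≤ u₂ ∧ u₂ ≤ e) (hv₂ : -c ≤ v₂ ∧ v₂ ≤ e) (hp₂ : -c ≤ p₂ ∧ p₂ ≤ e)
    (hp : EnclosesZero u₁ u₂ v₁ v₂ p₁ p₂) (hD : u₁ * v₂ ≠ u₂ * v₁) :
    HasSymmetricPair a b c e u₁ u₂ v₁ v₂ := by
  have aux : ∀ {a b c e u₁ u₂ v₁ v₂ p₁ p₂ : ℤ}, 0 ≤ a → 0 ≤ b → 0 ≤ c → 0 ≤ e →
      -a ≤ u₁ ∧ u₁ ≤ b → -a ≤ v₁ ∧ v₁ ≤ b → -a ≤ p₁ ∧ p₁ ≤ b →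
      -c ≤ u₂ ∧ u₂ ≤ e → -c ≤ v₂ ∧ v₂ ≤ e → -c ≤ p₂ ∧ p₂ ≤ e →
      EnclosesZero u₁ u₂ v₁ v₂ p₁ p₂ → u₁ * v₂ ≠ u₂ * v₁ → u₁ < -b →
      HasSymmetricPair a b c e u₁ u₂ v₁ v₂ := by
    intro a b c e u₁ u₂ v₁ v₂ p₁ p₂ ha hb hc he hu₁ hv₁ hp₁ hu₂ hv₂ hp₂ hp hD hu
    by_cases h : (-b ≤ v₁ ∧ v₁ ≤ a) ∧ (-e ≤ v₂ ∧ v₂ ≤ c)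
    · exact (hasSymmetricPair_of_neg_mem hv₁ hv₂ (fun h => hD (by linarith)) h.1 h.2).swap
    -- The alternative `a < v₁` is void, because `v₁ ≤ b < -u₁ ≤ a`.
    have : v₁ < -b ∨ v₂ < -e ∨ c < v₂ := by omega
    rcases this with hv | hv | hv
    · exact hasSymmetricPair_of_neg ha hb hu₂ hv₂ hp₂ hp hD (by omega) (by omega)
    · exact hasSymmetricPair_of_crossed ha hb hc he hu₁ hv₁ hp₁ hu₂ hv₂ hp₂ hp hD hu hv
    · refine HasSymmetricPair.reflect_snd (hasSymmetricPair_of_crossed ha hb he hc hu₁ hv₁ hp₁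
        ⟨?_, ?_⟩ ⟨?_, ?_⟩ ⟨?_, ?_⟩ hp.transpose.reflect_fst.transpose
        (fun h => hD (by linarith)) hu ?_) <;> omega
  by_cases h : (-b ≤ u₁ ∧ u₁ ≤ a) ∧ (-e ≤ u₂ ∧ u₂ ≤ c)
  · exact hasSymmetricPair_of_neg_mem hu₁ hu₂ hD h.1 h.2
  have : u₁ < -b ∨ a < u₁ ∨ u₂ < -e ∨ c < u₂ := by omega
  rcases this with hu | hu | hu | hu
  · exact aux ha hb hc he hu₁ hv₁ hp₁ hu₂ hv₂ hp₂ hp hD hu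
  · refine HasSymmetricPair.reflect_fst (aux hb ha hc he ⟨?_, ?_⟩ ⟨?_, ?_⟩ ⟨?_, ?_⟩
      hu₂ hv₂ hp₂ hp.reflect_fst (fun h => hD (by linarith)) ?_) <;> omega
  · exact (aux hc he ha hb hu₂ hv₂ hp₂ hu₁ hv₁ hp₁ hp.transpose (fun h => hD (by linarith))
      hu).transpose
  · refine HasSymmetricPair.transpose (HasSymmetricPair.reflect_fst (aux he hc ha hb
      ⟨?_, ?_⟩ ⟨?_, ?_⟩ ⟨?_, ?_⟩ hu₁ hv₁ hp₁ hp.transpose.reflect_fst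
      (fun h => hD (by linarith)) ?_)) <;> omega

/-- The point `z` lies strictly inside the triangle with vertices `x`, `y`, `q`
(which may be degenerate). -/
def StrictlyBetween {n : ℕ} (x y q z : Cube 2 n) : Prop :=
  ∃ l m d : ℤ, 0 < l ∧ 0 < m ∧ 0 < d ∧
    ∀ i, l * ((x i : ℤ) - z i) + m * ((y i : ℤ) - z i) + d * ((q i : ℤ) - z i) = 0

theorem affine_combination_eq {n : ℕ} {φ : Cube 2 n → ℝ} (hφ : φ ∈ affineFunctions 2 n)
    {x y q z : Cube 2 n} {l m d : ℤ}
    (h : ∀ i, l * ((x i : ℤ) - z i) + m * ((y i : ℤ) - z i) + d * ((q i : ℤ) - z i) = 0) :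
    l * (φ x - φ z) + m * (φ y - φ z) + d * (φ q - φ z) = 0 := by
  obtain ⟨a, c, hac⟩ := hφ
  have h0 : (l : ℝ) * ((x 0 : ℕ) - (z 0 : ℕ)) + m * ((y 0 : ℕ) - (z 0 : ℕ))
    + d * ((q 0 : ℕ) - (z 0 : ℕ)) = 0 := by exact_mod_cast h 0
  have h1 : (l : ℝ) * ((x 1 : ℕ) - (z 1 : ℕ)) + m * ((y 1 : ℕ) - (z 1 : ℕ))
    + d * ((q 1 : ℕ) - (z 1 : ℕ)) = 0 := by exact_mod_cast h 1
  simp only [hac, Fin.sum_univ_two, Cube.toReal]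
  linear_combination a 0 * h0 + a 1 * h1

theorem exists_represents_of_mem_essentialPoints {d n : ℕ} {g : Cube d n → Bool} {z : Cube d n}
    (hz : z ∈ essentialPoints (threshold d n) g) (hgz : g z = false) :
    ∃ φ ∈ affineFunctions d n, 0 < φ z ∧
      ∀ y, y ≠ z → (g y = true → 0 < φ y) ∧ (g y = false → φ y < 0) := by
  obtain ⟨h, hh, hne, heq⟩ := hz
  obtain ⟨φ, hφ, hr⟩ := mem_threshold_iff.1 hh
  refine ⟨φ, hφ, (hr z).1 ?_, fun y hy => ?_⟩
  · rw [hgz] at hne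
    simpa using hne.symm
  · rw [heq y hy]
    exact hr y

/-- Applying `φ` to the relation gives a vanishing sum of nonnegative terms. -/
theorem eq_zero_of_affine_relation {n : ℕ} {φ : Cube 2 n → ℝ} (hφ : φ ∈ affineFunctions 2 n)
    {x y w q : Cube 2 n} (hx : 0 < φ x) (hy : φ y < 0) (hw : φ w < 0) (hq : 0 < φ q)
    {r s t k : ℤ} (h : ∀ i, r * ((x i : ℕ) : ℤ) + s * (y i : ℕ) + t * (w i : ℕ) + k * (q i : ℕ) = 0)
    (hsum : r + s + t + k = 0) (hr : 0 ≤ r) (hs : s ≤ 0) (ht : t ≤ 0) (hk : 0 ≤ k) :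
    r = 0 ∧ s = 0 ∧ t = 0 ∧ k = 0 := by
  have h1 := affine_combination_eq hφ (x := x) (y := y) (q := q) (z := w) (l := r) (m := s) (d := k)
    (fun i => by linear_combination h i - ((w i : ℕ) : ℤ) * hsum)
  have hsum' : (r : ℝ) + s + t + k = 0 := by exact_mod_cast hsum
  have h2 : r * φ x + s * φ y + t * φ w + k * φ q = 0 := by
    linear_combination h1 + φ w * hsum'
  have hr' : (0 : ℝ) ≤ r := by exact_mod_cast hr
  have hs' : (s : ℝ) ≤ 0 := by exact_mod_cast hs
  have ht' : (t : ℝ) ≤ 0 := by exact_mod_cast ht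
  have hk' : (0 : ℝ) ≤ k := by exact_mod_cast hk
  have e1 := mul_nonneg hr' hx.le
  have e2 := mul_nonneg_of_nonpos_of_nonpos hs' hy.le
  have e3 := mul_nonneg_of_nonpos_of_nonpos ht' hw.le
  have e4 := mul_nonneg hk' hq.le
  refine ⟨?_, ?_, ?_, ?_⟩
  · have : (r : ℝ) * φ x = 0 := by linarith
    exact_mod_cast (mul_eq_zero.1 this).resolve_right hx.ne'
  · have : (s : ℝ) * φ y = 0 := by linarith
    exact_mod_cast (mul_eq_zero.1 this).resolve_right hy.ne
  · have : (t : ℝ) * φ w = 0 := by linarith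
    exact_mod_cast (mul_eq_zero.1 this).resolve_right hw.ne
  · have : (k : ℝ) * φ q = 0 := by linarith
    exact_mod_cast (mul_eq_zero.1 this).resolve_right hq.ne'

section ThreeZeros

variable {n : ℕ} {g : Cube 2 n → Bool} {x y w : Cube 2 n}

/-- In an affine relation between three essential zeros of a threshold function and a `1`-point,
exactly one of the zeros has a coefficient of the sign opposite to that of the `1`-point. -/
theorem sign_affine_relation (hg : g ∈ threshold 2 n)
    (hx : x ∈ essentialPoints (threshold 2 n) g) (hy : y ∈ essentialPoints (threshold 2 n) g)
    (hw : w ∈ essentialPoints (threshold 2 n) g)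
    (hgx : g x = false) (hgy : g y = false) (hgw : g w = false)
    (hxy : x ≠ y) (hxw : x ≠ w) (hyw : y ≠ w) {q : Cube 2 n} (hgq : g q = true)
    {r s t k : ℤ} (h : ∀ i, r * ((x i : ℕ) : ℤ) + s * (y i : ℕ) + t * (w i : ℕ) + k * (q i : ℕ) = 0)
    (hsum : r + s + t + k = 0) (hk : 0 ≤ k) :
    (r = 0 ∧ s = 0 ∧ t = 0 ∧ k = 0) ∨ (r < 0 ∧ 0 < s ∧ 0 < t) ∨ (0 < r ∧ s < 0 ∧ 0 < t) ∨
      (0 < r ∧ 0 < s ∧ t < 0) := by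
  have hq : ∀ {v}, g v = false → q ≠ v := fun hv e => by simp [← e, hgq] at hv
  obtain ⟨φx, mx, px, ax⟩ := exists_represents_of_mem_essentialPoints hx hgx
  obtain ⟨φy, my, py, ay⟩ := exists_represents_of_mem_essentialPoints hy hgy
  obtain ⟨φw, mw, pw, aw⟩ := exists_represents_of_mem_essentialPoints hw hgw
  -- Turning one essential zero into a 1-point leaves a threshold function, so the segment from that
  -- zero to `q` cannot meet the segment joining the other two.
  have nx : 0 ≤ r → s ≤ 0 → t ≤ 0 → r = 0 ∧ s = 0 ∧ t = 0 ∧ k = 0 := fun hr hs ht =>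
    eq_zero_of_affine_relation mx px ((ax y hxy.symm).2 hgy) ((ax w hxw.symm).2 hgw)
      ((ax q (hq hgx)).1 hgq) h hsum hr hs ht hk
  have ny : 0 ≤ s → r ≤ 0 → t ≤ 0 → s = 0 ∧ r = 0 ∧ t = 0 ∧ k = 0 := fun hs hr ht =>
    eq_zero_of_affine_relation my py ((ay x hxy).2 hgx) ((ay w hyw.symm).2 hgw)
      ((ay q (hq hgy)).1 hgq) (fun i => by linarith [h i]) (by linarith) hs hr ht hk
  have nw : 0 ≤ t → r ≤ 0 → s ≤ 0 → t = 0 ∧ r = 0 ∧ s = 0 ∧ k = 0 := fun ht hr hs =>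
    eq_zero_of_affine_relation mw pw ((aw x hxw).2 hgx) ((aw y hyw).2 hgy)
      ((aw q (hq hgw)).1 hgq) (fun i => by linarith [h i]) (by linarith) ht hr hs hk
  obtain ⟨φ, mφ, hφ⟩ := mem_threshold_iff.1 hg
  -- Since `g` itself is threshold, `q` is not in the convex hull of the three zeros.
  have n0 : r ≤ 0 → s ≤ 0 → t ≤ 0 → k = 0 ∧ r = 0 ∧ s = 0 ∧ (0 : ℤ) + t = 0 := by
    intro hr hs ht
    have h1 := affine_combination_eq mφ (x := x) (y := y) (q := w) (z := q)
      (l := r) (m := s) (d := t) (fun i => by linear_combination h i - ((q i : ℕ) : ℤ) * hsum)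
    have fx : φ x - φ q < 0 := by linarith [(hφ x).2 hgx, (hφ q).1 hgq]
    have fy : φ y - φ q < 0 := by linarith [(hφ y).2 hgy, (hφ q).1 hgq]
    have fw : φ w - φ q < 0 := by linarith [(hφ w).2 hgw, (hφ q).1 hgq]
    have hr' : (r : ℝ) ≤ 0 := by exact_mod_cast hr
    have hs' : (s : ℝ) ≤ 0 := by exact_mod_cast hs
    have ht' : (t : ℝ) ≤ 0 := by exact_mod_cast ht
    have e1 := mul_nonneg_of_nonpos_of_nonpos hr' fx.le
    have e2 := mul_nonneg_of_nonpos_of_nonpos hs' fy.le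
    have e3 := mul_nonneg_of_nonpos_of_nonpos ht' fw.le
    have z1 : r = 0 := by
      have : (r : ℝ) * (φ x - φ q) = 0 := by linarith
      exact_mod_cast (mul_eq_zero.1 this).resolve_right fx.ne
    have z2 : s = 0 := by
      have : (s : ℝ) * (φ y - φ q) = 0 := by linarith
      exact_mod_cast (mul_eq_zero.1 this).resolve_right fy.ne
    have z3 : t = 0 := by
      have : (t : ℝ) * (φ w - φ q) = 0 := by linarith
      exact_mod_cast (mul_eq_zero.1 this).resolve_right fw.ne
    omega
  omega

/-- A nontrivial relation among the three zeros alone (`k = 0`) would have exactly one negative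
coefficient, and so would its negation. -/
theorem not_collinear (hg : g ∈ threshold 2 n)
    (hx : x ∈ essentialPoints (threshold 2 n) g) (hy : y ∈ essentialPoints (threshold 2 n) g)
    (hw : w ∈ essentialPoints (threshold 2 n) g)
    (hgx : g x = false) (hgy : g y = false) (hgw : g w = false)
    (hxy : x ≠ y) (hxw : x ≠ w) (hyw : y ≠ w) {q : Cube 2 n} (hgq : g q = true) :
    (((x 0 : ℕ) : ℤ) - (w 0 : ℕ)) * ((y 1 : ℕ) - (w 1 : ℕ)) ≠
      ((x 1 : ℕ) - (w 1 : ℕ)) * ((y 0 : ℕ) - (w 0 : ℕ)) := by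
  intro hD
  have key : ∀ r s : ℤ, (∀ i, r * (((x i : ℕ) : ℤ) - (w i : ℕ)) + s * ((y i : ℕ) - (w i : ℕ)) = 0) →
      r = 0 ∧ s = 0 := by
    intro r s h
    have h1 := sign_affine_relation hg hx hy hw hgx hgy hgw hxy hxw hyw hgq
      (r := r) (s := s) (t := -r - s) (k := 0) (fun i => by linear_combination h i) (by ring) le_rfl
    have h2 := sign_affine_relation hg hx hy hw hgx hgy hgw hxy hxw hyw hgq
      (r := -r) (s := -s) (t := r + s) (k := 0) (fun i => by linear_combination -h i) (by ring)
      le_rfl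
    omega
  have h0 := key ((y 0 : ℕ) - (w 0 : ℕ)) (-((x 0 : ℕ) - (w 0 : ℕ))) (fun i => by
    fin_cases i
    · simp only [Fin.zero_eta]; ring
    · simp only [Fin.mk_one]; linear_combination -hD)
  have h1 := key ((y 1 : ℕ) - (w 1 : ℕ)) (-((x 1 : ℕ) - (w 1 : ℕ))) (fun i => by
    fin_cases i
    · simp only [Fin.zero_eta]; linear_combination hD
    · simp only [Fin.mk_one]; ring)
  apply hyw
  funext i
  apply Fin.ext
  fin_cases i
  · simp only [Fin.zero_eta]; omega
  · simp only [Fin.mk_one]; omega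

/-- Given three essential zeros of a threshold function and a `1`-point, one of the zeros lies
inside the triangle formed by the other points. -/
theorem exists_strictlyBetween (hg : g ∈ threshold 2 n)
    (hx : x ∈ essentialPoints (threshold 2 n) g) (hy : y ∈ essentialPoints (threshold 2 n) g)
    (hw : w ∈ essentialPoints (threshold 2 n) g)
    (hgx : g x = false) (hgy : g y = false) (hgw : g w = false)
    (hxy : x ≠ y) (hxw : x ≠ w) (hyw : y ≠ w) {q : Cube 2 n} (hgq : g q = true) :
    StrictlyBetween y w q x ∨ StrictlyBetween x w q y ∨ StrictlyBetween x y q w := by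
  have hD := not_collinear hg hx hy hw hgx hgy hgw hxy hxw hyw hgq
  obtain ⟨r, s, k, hk, h⟩ : ∃ r s k : ℤ, 0 < k ∧ ∀ i, r * (((x i : ℕ) : ℤ) - (w i : ℕ)) +
      s * ((y i : ℕ) - (w i : ℕ)) + k * ((q i : ℕ) - (w i : ℕ)) = 0 := by
    -- Cramer's rule: the coefficients are the 2×2 minors.
    have hcramer : ∃ r s k : ℤ, k ≠ 0 ∧ ∀ i, r * (((x i : ℕ) : ℤ) - (w i : ℕ)) +
        s * ((y i : ℕ) - (w i : ℕ)) + k * ((q i : ℕ) - (w i : ℕ)) = 0 := by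
      refine ⟨((y 0 : ℕ) - (w 0 : ℕ)) * ((q 1 : ℕ) - (w 1 : ℕ)) -
          ((y 1 : ℕ) - (w 1 : ℕ)) * ((q 0 : ℕ) - (w 0 : ℕ)),
        ((q 0 : ℕ) - (w 0 : ℕ)) * ((x 1 : ℕ) - (w 1 : ℕ)) -
          ((q 1 : ℕ) - (w 1 : ℕ)) * ((x 0 : ℕ) - (w 0 : ℕ)),
        ((x 0 : ℕ) - (w 0 : ℕ)) * ((y 1 : ℕ) - (w 1 : ℕ)) -
          ((x 1 : ℕ) - (w 1 : ℕ)) * ((y 0 : ℕ) - (w 0 : ℕ)), sub_ne_zero.2 hD, fun i => ?_⟩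
      fin_cases i
      · simp only [Fin.zero_eta]; ring
      · simp only [Fin.mk_one]; ring
    obtain ⟨r, s, k, hk, h⟩ := hcramer
    rcases hk.lt_or_gt with hk | hk
    · exact ⟨-r, -s, -k, by omega, fun i => by linear_combination -h i⟩
    · exact ⟨r, s, k, hk, h⟩
  rcases sign_affine_relation hg hx hy hw hgx hgy hgw hxy hxw hyw hgq
    (r := r) (s := s) (t := -r - s - k) (k := k) (fun i => by linear_combination h i) (by ring)
    hk.le with ⟨-, -, -, h0⟩ | ⟨h1, h2, h3⟩ | ⟨h1, h2, h3⟩ | ⟨h1, h2, h3⟩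
  · omega
  · exact Or.inl ⟨s, -r - s - k, k, h2, h3, hk, fun i => by linear_combination h i⟩
  · exact Or.inr (Or.inl ⟨r, -r - s - k, k, h1, h3, hk, fun i => by linear_combination h i⟩)
  · exact Or.inr (Or.inr ⟨r, s, k, h1, h2, hk, fun i => by linear_combination h i⟩)

/-- The zero that lies inside the triangle does not depend on the `1`-point. -/
theorem not_strictlyBetween_of_strictlyBetween
    (hw : w ∈ essentialPoints (threshold 2 n) g)
    (hgx : g x = false) (hgy : g y = false) (hgw : g w = false)
    (hxw : x ≠ w) (hyw : y ≠ w) {p q : Cube 2 n} (hgp : g p = true) (hgq : g q = true)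
    (hp : StrictlyBetween y w p x) : ¬ StrictlyBetween x w q y := by
  intro hq
  have hne : ∀ {v}, g v = true → v ≠ w := fun hv e => by simp [e, hgw] at hv
  obtain ⟨φ, mφ, pw, aw⟩ := exists_represents_of_mem_essentialPoints hw hgw
  obtain ⟨l, m, d, hl, hm, hd, h⟩ := hp
  obtain ⟨l', m', d', hl', hm', hd', h'⟩ := hq
  have e := affine_combination_eq mφ h
  have e' := affine_combination_eq mφ h'
  have fx := (aw x hxw).2 hgx
  have fy := (aw y hyw).2 hgy
  have fp := (aw p (hne hgp)).1 hgp
  have fq := (aw q (hne hgq)).1 hgq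
  have hl0 : (0 : ℝ) < l := by exact_mod_cast hl
  have hm0 : (0 : ℝ) < m := by exact_mod_cast hm
  have hd0 : (0 : ℝ) < d := by exact_mod_cast hd
  have hl0' : (0 : ℝ) < l' := by exact_mod_cast hl'
  have hm0' : (0 : ℝ) < m' := by exact_mod_cast hm'
  have hd0' : (0 : ℝ) < d' := by exact_mod_cast hd'
  -- A point inside a triangle cannot minimise `φ` unless `φ` is constant on the vertices; `φ` is
  -- positive at `w`, `p`, `q` and negative at `x`, `y`.
  rcases le_total (φ x) (φ y) with hxy | hxy
  · have e1 := mul_nonneg hl0.le (sub_nonneg.2 hxy)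
    have e2 := mul_pos hm0 (by linarith : 0 < φ w - φ x)
    have e3 := mul_pos hd0 (by linarith : 0 < φ p - φ x)
    linarith
  · have e1 := mul_nonneg hl0'.le (sub_nonneg.2 hxy)
    have e2 := mul_pos hm0' (by linarith : 0 < φ w - φ y)
    have e3 := mul_pos hd0' (by linarith : 0 < φ q - φ y)
    linarith

theorem StrictlyBetween.symm {q : Cube 2 n} (h : StrictlyBetween x y q w) :
    StrictlyBetween y x q w := by
  obtain ⟨l, m, d, hl, hm, hd, h⟩ := h
  exact ⟨m, l, d, hm, hl, hd, fun i => by linear_combination h i⟩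

theorem StrictlyBetween.enclosesZero {q : Cube 2 n} (h : StrictlyBetween x y q w) :
    EnclosesZero ((x 0 : ℕ) - (w 0 : ℕ)) ((x 1 : ℕ) - (w 1 : ℕ)) ((y 0 : ℕ) - (w 0 : ℕ))
      ((y 1 : ℕ) - (w 1 : ℕ)) ((q 0 : ℕ) - (w 0 : ℕ)) ((q 1 : ℕ) - (w 1 : ℕ)) := by
  obtain ⟨l, m, d, hl, hm, hd, h⟩ := h
  exact ⟨l, m, d, hl, hm, hd, h 0, h 1⟩

/-- All 1-points lie in the open cone at `w` opposite to the one spanned by `x - w` and `y - w`. A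
symmetric pair therefore gives two zeros with midpoint `w`, so `w` cannot be made a 1-point alone.
-/
theorem false_of_strictlyBetween (hg : g ∈ threshold 2 n)
    (hx : x ∈ essentialPoints (threshold 2 n) g) (hy : y ∈ essentialPoints (threshold 2 n) g)
    (hw : w ∈ essentialPoints (threshold 2 n) g)
    (hgx : g x = false) (hgy : g y = false) (hgw : g w = false)
    (hxy : x ≠ y) (hxw : x ≠ w) (hyw : y ≠ w) {p : Cube 2 n} (hgp : g p = true)
    (hp : StrictlyBetween x y p w) : False := by
  have hD := not_collinear hg hx hy hw hgx hgy hgw hxy hxw hyw hgp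
  have hall : ∀ q, g q = true → StrictlyBetween x y q w := by
    intro q hgq
    rcases exists_strictlyBetween hg hx hy hw hgx hgy hgw hxy hxw hyw hgq with h | h | h
    · exact absurd h (not_strictlyBetween_of_strictlyBetween hy hgw hgx hgy hyw.symm hxy hgp hgq
        hp |> fun h' h => h' h.symm)
    · exact absurd h (not_strictlyBetween_of_strictlyBetween hx hgw hgy hgx hxw.symm hxy.symm hgp hgq
        hp.symm |> fun h' h => h' h.symm)
    · exact h
  have hlt : ∀ (v : Cube 2 n) i, (v i : ℕ) < n := fun v i => (v i).2
  obtain ⟨s₁, s₂, hs, h₁, h₂, hpos, hneg⟩ := hasSymmetricPair_of_enclosesZero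
    (a := (w 0 : ℕ)) (b := n - 1 - (w 0 : ℕ)) (c := (w 1 : ℕ)) (e := n - 1 - (w 1 : ℕ))
    (by omega) (by have := hlt w 0; omega) (by omega) (by have := hlt w 1; omega)
    (by have := hlt x 0; omega) (by have := hlt y 0; omega) (by have := hlt p 0; omega)
    (by have := hlt x 1; omega) (by have := hlt y 1; omega) (by have := hlt p 1; omega)
    hp.enclosesZero hD
  obtain ⟨q, hq0, hq1⟩ : ∃ q : Cube 2 n, ((q 0 : ℕ) : ℤ) = (w 0 : ℕ) + s₁ ∧
      ((q 1 : ℕ) : ℤ) = (w 1 : ℕ) + s₂ :=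
    ⟨![⟨((w 0 : ℕ) + s₁).toNat, by omega⟩, ⟨((w 1 : ℕ) + s₂).toNat, by omega⟩],
      by simp; omega, by simp; omega⟩
  obtain ⟨q', hq0', hq1'⟩ : ∃ q : Cube 2 n, ((q 0 : ℕ) : ℤ) = (w 0 : ℕ) - s₁ ∧
      ((q 1 : ℕ) : ℤ) = (w 1 : ℕ) - s₂ :=
    ⟨![⟨((w 0 : ℕ) - s₁).toNat, by omega⟩, ⟨((w 1 : ℕ) - s₂).toNat, by omega⟩],
      by simp; omega, by simp; omega⟩
  have hgq : g q = false := by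
    by_contra h
    have := (hall q (by simpa using h)).enclosesZero
    rw [hq0, hq1, add_sub_cancel_left, add_sub_cancel_left] at this
    exact hpos this
  have hgq' : g q' = false := by
    by_contra h
    have := (hall q' (by simpa using h)).enclosesZero
    rw [hq0', hq1', sub_sub_cancel_left, sub_sub_cancel_left] at this
    exact hneg this
  have hqw : q ≠ w := by
    rintro rfl
    omega
  have hqw' : q' ≠ w := by
    rintro rfl
    omega
  obtain ⟨φ, mφ, pw, aw⟩ := exists_represents_of_mem_essentialPoints hw hgw
  have e := affine_combination_eq mφ (x := q) (y := q') (q := w) (z := w) (l := 1) (m := 1) (d := 0)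
    (fun i => by
      fin_cases i
      · simp only [Fin.zero_eta]; linear_combination hq0 + hq0'
      · simp only [Fin.mk_one]; linear_combination hq1 + hq1')
  have f1 := (aw q hqw).2 hgq
  have f2 := (aw q' hqw').2 hgq'
  push_cast at e
  linarith

theorem not_three_essential_zeros (hg : g ∈ threshold 2 n)
    (hx : x ∈ essentialPoints (threshold 2 n) g) (hy : y ∈ essentialPoints (threshold 2 n) g)
    (hw : w ∈ essentialPoints (threshold 2 n) g)
    (hgx : g x = false) (hgy : g y = false) (hgw : g w = false)
    (hxy : x ≠ y) (hxw : x ≠ w) (hyw : y ≠ w) {p : Cube 2 n} (hgp : g p = true) : False := by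
  rcases exists_strictlyBetween hg hx hy hw hgx hgy hgw hxy hxw hyw hgp with h | h | h
  · exact false_of_strictlyBetween hg hy hw hx hgy hgw hgx hyw hxy.symm hxw.symm hgp h
  · exact false_of_strictlyBetween hg hx hw hy hgx hgw hgy hxw hxy hyw.symm hgp h
  · exact false_of_strictlyBetween hg hx hy hw hgx hgy hgw hxy hxw hyw hgp h

end ThreeZeros

theorem encard_essential_zeros_le {n : ℕ} {g : Cube 2 n → Bool} (hg : g ∈ threshold 2 n)
    {p : Cube 2 n} (hgp : g p = true) :
    (essentialPoints (threshold 2 n) g ∩ {x | g x = false}).encard ≤ 2 := by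
  by_contra h
  rw [not_le, ← Set.Finite.cast_ncard_eq (Set.toFinite _)] at h
  obtain ⟨x, y, w, hx, hy, hw, hxy, hxw, hyw⟩ :=
    (Set.two_lt_ncard_iff (Set.toFinite _)).1 (by exact_mod_cast h)
  exact not_three_essential_zeros hg hx.1 hy.1 hw.1 hx.2 hy.2 hw.2 hxy hxw hyw hgp

/-- Otherwise `x` is the midpoint of its two neighbours in direction `i`, both zeros. -/
theorem eq_zero_or_eq_of_mem_essentialPoints_of_forall_eq_false {n : ℕ} {g : Cube 2 n → Bool}
    (hg : ∀ x, g x = false) {x : Cube 2 n} (hx : x ∈ essentialPoints (threshold 2 n) g)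
    (i : Fin 2) : (x i : ℕ) = 0 ∨ (x i : ℕ) = n - 1 := by
  by_contra hcon
  have hlt := (x i).2
  obtain ⟨φ, mφ, pw, aw⟩ := exists_represents_of_mem_essentialPoints hx (hg x)
  let y := Function.update x i ⟨(x i : ℕ) + 1, by omega⟩
  let z := Function.update x i ⟨(x i : ℕ) - 1, by omega⟩
  have hy : y ≠ x := fun h => by
    have := congrArg Fin.val (congrFun h i)
    simp [y] at this
  have hz : z ≠ x := fun h => by
    have := congrArg Fin.val (congrFun h i)
    simp [z] at this
    omega
  have e := affine_combination_eq mφ (x := y) (y := z) (q := x) (z := x) (l := 1) (m := 1) (d := 0)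
    (fun j => by
      by_cases h : j = i
      · subst h
        simp only [y, z, Function.update_self]
        omega
      · simp [y, z, h])
  have f1 := (aw y hy).2 (hg y)
  have f2 := (aw z hz).2 (hg z)
  push_cast at e
  linarith

theorem encard_essentialPoints_le_of_forall_eq_false {n : ℕ} {g : Cube 2 n → Bool}
    (hg : ∀ x, g x = false) : (essentialPoints (threshold 2 n) g).encard ≤ 4 := by
  rw [← Set.Finite.cast_ncard_eq (Set.toFinite _)]
  have := Set.ncard_le_ncard_of_injOn (s := essentialPoints (threshold 2 n) g)
    (t := (Set.univ : Set (Bool × Bool)))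
    (fun x => (decide ((x 0 : ℕ) = 0), decide ((x 1 : ℕ) = 0))) (fun _ _ => Set.mem_univ _) (by
      intro x hx y hy hxy
      have hx' := eq_zero_or_eq_of_mem_essentialPoints_of_forall_eq_false hg hx
      have hy' := eq_zero_or_eq_of_mem_essentialPoints_of_forall_eq_false hg hy
      simp only [Prod.mk.injEq, decide_eq_decide] at hxy
      funext i
      apply Fin.ext
      have := hx' i
      have := hy' i
      fin_cases i
      · simp only [Fin.zero_eta] at *; omega
      · simp only [Fin.mk_one] at *; omega)
  rw [Set.ncard_univ] at this
  simp at this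
  exact_mod_cast this

theorem encard_essentialPoints_le {n : ℕ} {g : Cube 2 n → Bool} (hg : g ∈ threshold 2 n) :
    (essentialPoints (threshold 2 n) g).encard ≤ 4 := by
  by_cases h₀ : ∀ x, g x = false
  · exact encard_essentialPoints_le_of_forall_eq_false h₀
  by_cases h₁ : ∀ x, g x = true
  · rw [← essentialPoints_not]
    exact encard_essentialPoints_le_of_forall_eq_false fun x => by simp [h₁ x]
  push Not at h₀ h₁
  obtain ⟨p, hp⟩ := h₀
  obtain ⟨q, hq⟩ := h₁
  have e₀ := encard_essential_zeros_le hg (p := p) (by simpa using hp)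
  have e₁ := encard_essential_zeros_le (not_mem_threshold hg) (p := q) (by simpa using hq)
  rw [essentialPoints_not] at e₁
  calc (essentialPoints (threshold 2 n) g).encard
      ≤ ((essentialPoints (threshold 2 n) g ∩ {x | g x = false}) ∪
          (essentialPoints (threshold 2 n) g ∩ {x | (!g x) = false})).encard := by
        refine Set.encard_le_encard fun x hx => ?_
        cases h : g x
        · exact Or.inl ⟨hx, h⟩
        · exact Or.inr ⟨hx, by simp [h]⟩
    _ ≤ 2 + 2 := (Set.encard_union_le _ _).trans (add_le_add e₀ e₁)
    _ = 4 := by norm_num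

/-! ### Cyclic cuts around a point of the border -/

theorem eq_zero_or_eq_of_mem_cubeBorder {d n : ℕ} {x : Cube d n} (hx : x ∈ cubeBorder d n) :
    ∃ i, (x i : ℕ) = 0 ∨ (x i : ℕ) = n - 1 := by
  by_contra hcon
  push Not at hcon
  refine hx.2 ?_
  have hrange : Set.range (Cube.toReal : Cube d n → Fin d → ℝ) =
      Set.univ.pi fun _ => Set.range fun k : Fin n => ((k : ℕ) : ℝ) := by
    ext y
    simp only [Set.mem_range, Set.mem_univ_pi]
    constructor
    · rintro ⟨x, rfl⟩ i
      exact ⟨x i, rfl⟩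
    · intro h
      choose x hx using h
      exact ⟨x, funext hx⟩
  rw [hrange, convexHull_pi, interior_pi_set Set.finite_univ, Set.mem_univ_pi]
  intro i
  have hlt := (x i).2
  obtain ⟨h0, h1⟩ := hcon i
  have hsub : Set.Icc (0 : ℝ) ((n - 1 : ℕ) : ℝ) ⊆
      convexHull ℝ (Set.range fun k : Fin n => ((k : ℕ) : ℝ)) := by
    rw [← segment_eq_Icc (by positivity)]
    exact segment_subset_convexHull ⟨⟨0, by omega⟩, by simp⟩ ⟨⟨n - 1, by omega⟩, rfl⟩
  refine interior_mono hsub ?_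
  rw [interior_Icc]
  refine ⟨?_, ?_⟩
  · simp only [Cube.toReal, Nat.cast_pos]
    omega
  · simp only [Cube.toReal, Nat.cast_lt]
    omega

/-- A point of the cone spanned by `u` and `v` cannot be cut off from `0`, `u`, `v` by one line
while another line cuts `u` and `v` off from it and `0`. -/
theorem not_cut_of_mem_cone {a b c a' b' c' α β m₀ t₀ m₁ t₁ m t : ℝ} (hα : 0 ≤ α) (hβ : 0 ≤ β)
    (hm : m = α * m₀ + β * m₁) (ht : t = α * t₀ + β * t₁) (hc : c < 0) (hc' : c' < 0)
    (h₀ : 0 < a * m₀ + b * t₀ + c) (h₁ : 0 < a * m₁ + b * t₁ + c) (h : a * m + b * t + c < 0)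
    (h₀' : a' * m₀ + b' * t₀ + c' < 0) (h₁' : a' * m₁ + b' * t₁ + c' < 0)
    (h' : 0 < a' * m + b' * t + c') : False := by
  subst hm ht
  have e₀ := mul_nonneg hα h₀.le
  have e₁ := mul_nonneg hβ h₁.le
  have e₀' := mul_nonpos_of_nonneg_of_nonpos hα h₀'.le
  have e₁' := mul_nonpos_of_nonneg_of_nonpos hβ h₁'.le
  -- The first line forces `α + β < 1`, the second `α + β > 1`.
  have k : (α + β - 1) * c > 0 := by linarith
  have k' : (α + β - 1) * c' < 0 := by linarith
  rcases le_total 0 (α + β - 1) with hs | hs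
  · exact absurd (mul_nonpos_of_nonneg_of_nonpos hs hc.le) (by linarith)
  · exact absurd (mul_nonneg_of_nonpos_of_nonpos hs hc'.le) (by linarith)

theorem exists_cone_coefficients {m₀ t₀ m₁ t₁ m t : ℝ} (h₀ : 0 < m₀) (h₁ : 0 < m₁) (h : 0 < m)
    (hle₀ : t₀ / m₀ ≤ t / m) (hle₁ : t / m ≤ t₁ / m₁) :
    ∃ α β, 0 ≤ α ∧ 0 ≤ β ∧ m = α * m₀ + β * m₁ ∧ t = α * t₀ + β * t₁ := by
  rcases (hle₀.trans hle₁).eq_or_lt with heq | hlt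
  · refine ⟨m / m₀, 0, by positivity, le_rfl, by field_simp; simp, ?_⟩
    have : t₀ / m₀ = t / m := le_antisymm hle₀ (heq ▸ hle₁)
    field_simp at this ⊢
    linarith
  · rw [div_le_div_iff₀ h₀ h] at hle₀
    rw [div_le_div_iff₀ h h₁] at hle₁
    rw [div_lt_div_iff₀ h₀ h₁] at hlt
    have hD : 0 < t₁ * m₀ - t₀ * m₁ := by linarith
    have hD' := hD.ne'
    refine ⟨(t₁ * m - t * m₁) / (t₁ * m₀ - t₀ * m₁), (t * m₀ - t₀ * m) / (t₁ * m₀ - t₀ * m₁),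
      div_nonneg (by linarith) hD.le, div_nonneg (by linarith) hD.le, ?_, ?_⟩
    · rw [div_mul_eq_mul_div, div_mul_eq_mul_div, ← add_div, eq_div_iff hD']
      ring
    · rw [div_mul_eq_mul_div, div_mul_eq_mul_div, ← add_div, eq_div_iff hD']
      ring

/-- Four points of an open half plane bounded by a line through the origin cannot be arranged
cyclically in such a way that each pair of consecutive points is cut off from the origin and
the other points by a line. -/
theorem not_cyclic_cuts_of_pos {m t a b c : Fin 4 → ℝ} (hm : ∀ i, 0 < m i) (hc : ∀ i, c i < 0)
    (h₀ : ∀ i, 0 < a i * m i + b i * t i + c i)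
    (h₁ : ∀ i, 0 < a i * m (i + 1) + b i * t (i + 1) + c i)
    (h₂ : ∀ i, a i * m (i + 2) + b i * t (i + 2) + c i < 0)
    (h₃ : ∀ i, a i * m (i + 3) + b i * t (i + 3) + c i < 0) : False := by
  obtain ⟨i, hi⟩ := Finite.exists_min fun i => t i / m i
  have e22 : i + 2 + 2 = i := (by decide : ∀ i : Fin 4, i + 2 + 2 = i) i
  have e23 : i + 2 + 3 = i + 1 := (by decide : ∀ i : Fin 4, i + 2 + 3 = i + 1) i
  have e21 : i + 2 + 1 = i + 3 := (by decide : ∀ i : Fin 4, i + 2 + 1 = i + 3) i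
  have e31 : i + 3 + 1 = i := (by decide : ∀ i : Fin 4, i + 3 + 1 = i) i
  have e32 : i + 3 + 2 = i + 1 := (by decide : ∀ i : Fin 4, i + 3 + 2 = i + 1) i
  have e12 : i + 1 + 2 = i + 3 := (by decide : ∀ i : Fin 4, i + 1 + 2 = i + 3) i
  have e13 : i + 1 + 3 = i := (by decide : ∀ i : Fin 4, i + 1 + 3 = i) i
  -- Of the two neighbours of the point `i` of least slope, the one of smaller slope lies in the
  -- cone spanned by `i` and the other neighbour.
  rcases le_total (t (i + 1) / m (i + 1)) (t (i + 3) / m (i + 3)) with hle | hle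
  · obtain ⟨α, β, hα, hβ, e, e'⟩ :=
      exists_cone_coefficients (hm i) (hm (i + 3)) (hm (i + 1)) (hi _) hle
    exact not_cut_of_mem_cone hα hβ e e' (hc (i + 3)) (hc (i + 1))
      (by simpa only [e31] using h₁ (i + 3)) (h₀ (i + 3)) (by simpa only [e32] using h₂ (i + 3))
      (by simpa only [e13] using h₃ (i + 1)) (by simpa only [e12] using h₂ (i + 1)) (h₀ (i + 1))
  · obtain ⟨α, β, hα, hβ, e, e'⟩ :=
      exists_cone_coefficients (hm i) (hm (i + 1)) (hm (i + 3)) (hi _) hle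
    exact not_cut_of_mem_cone hα hβ e e' (hc i) (hc (i + 2)) (h₀ i) (h₁ i) (h₃ i)
      (by simpa only [e22] using h₂ (i + 2)) (by simpa only [e23] using h₃ (i + 2))
      (by simpa only [e21] using h₁ (i + 2))

/-- Moving the origin slightly out of the half plane makes every `m i` positive and keeps every `c
i` negative. -/
theorem not_cyclic_cuts_of_nonneg {m t a b c : Fin 4 → ℝ} (hm : ∀ i, 0 ≤ m i) (hc : ∀ i, c i < 0)
    (h₀ : ∀ i, 0 < a i * m i + b i * t i + c i)
    (h₁ : ∀ i, 0 < a i * m (i + 1) + b i * t (i + 1) + c i)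
    (h₂ : ∀ i, a i * m (i + 2) + b i * t (i + 2) + c i < 0)
    (h₃ : ∀ i, a i * m (i + 3) + b i * t (i + 3) + c i < 0) : False := by
  have hev : ∀ᶠ ε in nhdsWithin (0 : ℝ) (Set.Ioi 0), ∀ i, c i - a i * ε < 0 := by
    refine Filter.eventually_all.2 fun i => eventually_nhdsWithin_of_eventually_nhds ?_
    have hcont : Continuous fun ε : ℝ => c i - a i * ε := by fun_prop
    exact (hcont.tendsto 0).eventually_lt_const (by simpa using hc i)
  obtain ⟨ε, hε, hε₀⟩ := (hev.and self_mem_nhdsWithin).exists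
  have hε₀ : 0 < ε := hε₀
  refine not_cyclic_cuts_of_pos (m := fun i => m i + ε) (t := t) (a := a) (b := b)
    (c := fun i => c i - a i * ε) (fun i => by linarith [hm i]) hε (fun i => ?_) (fun i => ?_)
    (fun i => ?_) fun i => ?_
  · linarith [h₀ i]
  · linarith [h₁ i]
  · linarith [h₂ i]
  · linarith [h₃ i]

/-- A point of the border of the square cannot be surrounded by four points arranged cyclically
in such a way that each pair of consecutive points is the set of zeros of a threshold function
among the five points. -/
theorem not_cyclic_cuts {n : ℕ} {x : Cube 2 n} (hx : x ∈ cubeBorder 2 n) {z : Fin 4 → Cube 2 n}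
    {g : Fin 4 → Cube 2 n → Bool} (hg : ∀ i, g i ∈ threshold 2 n) (hgx : ∀ i, g i x = true)
    (h₀ : ∀ i, g i (z i) = false) (h₁ : ∀ i, g i (z (i + 1)) = false)
    (h₂ : ∀ i, g i (z (i + 2)) = true) (h₃ : ∀ i, g i (z (i + 3)) = true) : False := by
  obtain ⟨k, hk⟩ := eq_zero_or_eq_of_mem_cubeBorder hx
  -- `σ` orients coordinate `k` towards the inside of the square.
  obtain ⟨σ, hσ, hσz⟩ : ∃ σ : ℝ, σ * σ = 1 ∧ ∀ y : Cube 2 n, 0 ≤ σ * (y.toReal k - x.toReal k) := by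
    rcases hk with hk | hk
    · exact ⟨1, by norm_num, fun y => by simp [Cube.toReal, hk]⟩
    · refine ⟨-1, by norm_num, fun y => ?_⟩
      have h1 : (y k : ℕ) ≤ x k := by have := (y k).2; omega
      have h2 : ((y k : ℕ) : ℝ) ≤ (x k : ℕ) := by exact_mod_cast h1
      simp only [Cube.toReal]
      linarith
  choose φ hφ hr using fun i => mem_threshold_iff.1 (hg i)
  choose a c hac using hφ
  obtain ⟨j, hj⟩ : ∃ j : Fin 2, ∀ f : Fin 2 → ℝ, ∑ i, f i = f k + f j := by
    fin_cases k
    · exact ⟨1, fun f => by simp⟩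
    · exact ⟨0, fun f => by simp [add_comm]⟩
  have key : ∀ i y, -(φ i y) = -(a i k * σ) * (σ * (y.toReal k - x.toReal k)) +
      -(a i j) * (y.toReal j - x.toReal j) + -(φ i x) := by
    intro i y
    rw [hac, hac, hj, hj]
    linear_combination a i k * (y.toReal k - x.toReal k) * hσ
  refine not_cyclic_cuts_of_nonneg (m := fun i => σ * ((z i).toReal k - x.toReal k))
    (t := fun i => (z i).toReal j - x.toReal j) (a := fun i => -(a i k * σ))
    (b := fun i => -(a i j)) (c := fun i => -(φ i x)) (fun i => hσz _)
    (fun i => by linarith [(hr i x).1 (hgx i)]) (fun i => ?_) (fun i => ?_) (fun i => ?_)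
    fun i => ?_
  · rw [← key]
    linarith [(hr i _).2 (h₀ i)]
  · rw [← key]
    linarith [(hr i _).2 (h₁ i)]
  · rw [← key]
    linarith [(hr i _).1 (h₂ i)]
  · rw [← key]
    linarith [(hr i _).1 (h₃ i)]

/-! ### The main theorem -/

theorem exists_threshold_of_mem_kThreshold_two {d n : ℕ} {g : Cube d n → Bool}
    (hg : g ∈ kThreshold d n 2) :
    ∃ g₁ ∈ threshold d n, ∃ g₂ ∈ threshold d n,
      ∀ x, g x = true ↔ g₁ x = true ∧ g₂ x = true := by
  classical
  obtain ⟨a, a₀, h⟩ := hg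
  refine ⟨fun x => decide (∑ j, a 0 j * x.toReal j ≤ a₀ 0), ⟨a 0, a₀ 0, by simp [levelSet]⟩,
    fun x => decide (∑ j, a 1 j * x.toReal j ≤ a₀ 1), ⟨a 1, a₀ 1, by simp [levelSet]⟩, fun x => ?_⟩
  have := Set.ext_iff.1 h x
  simpa [levelSet, Fin.forall_fin_two] using this

theorem IsDefiningSet.eq_true_iff {d n k : ℕ} {F : Set (Cube d n → Bool)} {f : Cube d n → Bool}
    (h : IsDefiningSet k F f) (x : Cube d n) : f x = true ↔ ∀ g ∈ F, g x = true := by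
  obtain ⟨g, -, rfl, hf⟩ := h
  simp [hf]

theorem IsDefiningSet.subset_threshold {d n k : ℕ} {F : Set (Cube d n → Bool)}
    {f : Cube d n → Bool} (h : IsDefiningSet k F f) : F ⊆ threshold d n := by
  obtain ⟨g, hg, rfl, -⟩ := h
  rintro _ ⟨i, rfl⟩
  exact hg i

/-- Threshold functions `g₁`, `g₂` whose conjunction agrees with `f₁ ∧ f₂` at the essential
points of `f₁` and `f₂` and at a `1`-point of the border are `f₁`, `f₂` in some order. -/
theorem eq_and_eq_or_of_agree {n : ℕ} {f₁ f₂ g₁ g₂ : Cube 2 n → Bool}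
    (hf₁ : f₁ ∈ threshold 2 n) (hf₂ : f₂ ∈ threshold 2 n)
    (hg₁ : g₁ ∈ threshold 2 n) (hg₂ : g₂ ∈ threshold 2 n)
    (h₁ : ∀ x ∈ essentialPoints (threshold 2 n) f₁, f₂ x = true)
    (h₂ : ∀ x ∈ essentialPoints (threshold 2 n) f₂, f₁ x = true)
    {x : Cube 2 n} (hx : x ∈ cubeBorder 2 n) (hf₁x : f₁ x = true) (hf₂x : f₂ x = true)
    (hg₁x : g₁ x = true) (hg₂x : g₂ x = true)
    (H₁ : ∀ y ∈ essentialPoints (threshold 2 n) f₁,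
      (g₁ y = true ∧ g₂ y = true ↔ f₁ y = true))
    (H₂ : ∀ y ∈ essentialPoints (threshold 2 n) f₂,
      (g₁ y = true ∧ g₂ y = true ↔ f₂ y = true)) :
    (g₁ = f₁ ∧ g₂ = f₂) ∨ (g₁ = f₂ ∧ g₂ = f₁) := by
  -- At an essential 1-point of `f` both `g` and `g'` are 1, so `g` can differ from `f` only at an
  -- essential zero, where `g'` must then vanish.
  have split : ∀ {f g g' : Cube 2 n → Bool}, f ∈ threshold 2 n → g ∈ threshold 2 n →
      (∀ y ∈ essentialPoints (threshold 2 n) f, (g y = true ∧ g' y = true ↔ f y = true)) →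
      g = f ∨ ∃ z ∈ essentialPoints (threshold 2 n) f, f z = false ∧ g z = true ∧ g' z = false := by
    intro f g g' hf hg H
    by_cases hz : ∃ z ∈ essentialPoints (threshold 2 n) f, f z = false ∧ g z = true ∧ g' z = false
    · exact Or.inr hz
    refine Or.inl (isTeachingSet_essentialPoints hf g hg fun y hy => ?_)
    push Not at hz
    have h1 := H y hy
    have h2 := hz y hy
    cases hfy : f y <;> cases hgy : g y <;> simp_all
  have H₁' : ∀ y ∈ essentialPoints (threshold 2 n) f₁,
      (g₂ y = true ∧ g₁ y = true ↔ f₁ y = true) := fun y hy => by rw [and_comm]; exact H₁ y hy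
  have H₂' : ∀ y ∈ essentialPoints (threshold 2 n) f₂,
      (g₂ y = true ∧ g₁ y = true ↔ f₂ y = true) := fun y hy => by rw [and_comm]; exact H₂ y hy
  rcases split hf₁ hg₁ H₁ with e₁ | ⟨w, hw, hfw, hg₁w, hg₂w⟩
  · rcases split hf₂ hg₂ H₂' with e₂ | ⟨v, hv, hfv, hg₂v, hg₁v⟩
    · exact Or.inl ⟨e₁, e₂⟩
    · rw [e₁, h₂ v hv] at hg₁v
      cases hg₁v
  rcases split hf₁ hg₂ H₁' with e₁ | ⟨z, hz, hfz, hg₂z, hg₁z⟩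
  · rcases split hf₂ hg₁ H₂ with e₂ | ⟨v, hv, hfv, hg₁v, hg₂v⟩
    · exact Or.inr ⟨e₂, e₁⟩
    · rw [e₁, h₂ v hv] at hg₂v
      cases hg₂v
  rcases split hf₂ hg₁ H₂ with e₂ | ⟨w', hw', hfw', hg₁w', hg₂w'⟩
  · rw [e₂, h₁ z hz] at hg₁z
    cases hg₁z
  rcases split hf₂ hg₂ H₂' with e₂ | ⟨z', hz', hfz', hg₂z', hg₁z'⟩
  · rw [e₂, h₁ w hw] at hg₂w
    cases hg₂w
  exfalso
  -- In this order `f₁` vanishes at `z, w`, `g₂` at `w, w'`, `f₂` at `w', z'` and `g₁` at `z', z`.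
  refine not_cyclic_cuts hx (z := ![z, w, w', z']) (g := ![f₁, g₂, f₂, g₁]) ?_ ?_ ?_ ?_ ?_ ?_ <;>
  · intro i
    fin_cases i <;> simp [*]

/-- Yields both the teaching property and, when `g₁ ∧ g₂ = f` everywhere, the uniqueness of the
defining set. -/
theorem eq_and_eq_or_of_agree_conj {n : ℕ} {f f₁ f₂ : Cube 2 n → Bool} (hdef : IsDefiningSet 2 {f₁, f₂} f)
    (h₁ : ∀ x ∈ essentialPoints (threshold 2 n) f₁, f₂ x = true)
    (h₂ : ∀ x ∈ essentialPoints (threshold 2 n) f₂, f₁ x = true)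
    {x : Cube 2 n} (hx : x ∈ levelSet true f ∩ cubeBorder 2 n) {g₁ g₂ : Cube 2 n → Bool}
    (hg₁ : g₁ ∈ threshold 2 n) (hg₂ : g₂ ∈ threshold 2 n)
    (hg : ∀ y ∈ essentialPoints (threshold 2 n) f₁ ∪ essentialPoints (threshold 2 n) f₂ ∪ {x},
      (g₁ y = true ∧ g₂ y = true ↔ f y = true)) :
    (g₁ = f₁ ∧ g₂ = f₂) ∨ (g₁ = f₂ ∧ g₂ = f₁) := by
  have hf : ∀ y, f y = true ↔ f₁ y = true ∧ f₂ y = true := fun y => by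
    simpa using hdef.eq_true_iff y
  have hfx := (hf x).1 hx.1
  have hgx := (hg x (by simp)).2 hx.1
  refine eq_and_eq_or_of_agree (hdef.subset_threshold (by simp)) (hdef.subset_threshold (by simp))
    hg₁ hg₂ h₁ h₂ hx.2 hfx.1 hfx.2 hgx.1 hgx.2 (fun y hy => ?_) fun y hy => ?_
  · rw [hg y (Or.inl (Or.inl hy)), hf]
    simp [h₁ y hy]
  · rw [hg y (Or.inl (Or.inr hy)), hf]
    simp [h₂ y hy]

theorem theorem3 (n : ℕ) (hn : 2 ≤ n) (f : Cube 2 n → Bool) (hf : f ∈ kThreshold 2 n 2)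
    (hborder : (levelSet true f ∩ cubeBorder 2 n).Nonempty)
    (f₁ f₂ : Cube 2 n → Bool) (hdef : IsDefiningSet 2 {f₁, f₂} f)
    (h₁ : essentialPoints (threshold 2 n) f₁ ∩ levelSet false f₂ = ∅)
    (h₂ : essentialPoints (threshold 2 n) f₂ ∩ levelSet false f₁ = ∅) :
    (∀ F : Set (Cube 2 n → Bool), IsDefiningSet 2 F f → F = {f₁, f₂}) ∧
    teachingNumber (kThreshold 2 n 2) f ≤ 9 ∧
    ∀ x ∈ levelSet true f ∩ cubeBorder 2 n,
      IsTeachingSet (kThreshold 2 n 2) f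
        (essentialPoints (threshold 2 n) f₁ ∪ essentialPoints (threshold 2 n) f₂ ∪ {x}) ∧
      (essentialPoints (threshold 2 n) f₁ ∪ essentialPoints (threshold 2 n) f₂ ∪ {x}).encard ≤ 9 := by
  have h₁' : ∀ x ∈ essentialPoints (threshold 2 n) f₁, f₂ x = true := fun x hx => by
    by_contra h
    exact (Set.ext_iff.1 h₁ x).1 ⟨hx, by simpa [levelSet] using h⟩
  have h₂' : ∀ x ∈ essentialPoints (threshold 2 n) f₂, f₁ x = true := fun x hx => by
    by_contra h
    exact (Set.ext_iff.1 h₂ x).1 ⟨hx, by simpa [levelSet] using h⟩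
  have main : ∀ x ∈ levelSet true f ∩ cubeBorder 2 n,
      IsTeachingSet (kThreshold 2 n 2) f
        (essentialPoints (threshold 2 n) f₁ ∪ essentialPoints (threshold 2 n) f₂ ∪ {x}) ∧
      (essentialPoints (threshold 2 n) f₁ ∪ essentialPoints (threshold 2 n) f₂ ∪ {x}).encard ≤ 9 := by
    refine fun x hx => ⟨fun g hg hgT => ?_, ?_⟩
    · obtain ⟨g₁, hg₁, g₂, hg₂, hgg⟩ := exists_threshold_of_mem_kThreshold_two hg
      have hff : ∀ y, f y = true ↔ f₁ y = true ∧ f₂ y = true := fun y => by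
        simpa using hdef.eq_true_iff y
      funext y
      rw [Bool.eq_iff_iff, hgg, hff]
      rcases eq_and_eq_or_of_agree_conj hdef h₁' h₂' hx hg₁ hg₂
        (fun y hy => by rw [← hgg, hgT y hy]) with ⟨rfl, rfl⟩ | ⟨rfl, rfl⟩
      · rfl
      · exact and_comm
    · calc _ ≤ (4 : ℕ∞) + 4 + 1 := by
            refine (Set.encard_union_le _ _).trans (add_le_add ?_ (Set.encard_singleton x).le)
            exact (Set.encard_union_le _ _).trans (add_le_add
              (encard_essentialPoints_le (hdef.subset_threshold (by simp)))
              (encard_essentialPoints_le (hdef.subset_threshold (by simp))))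
        _ = 9 := by norm_num
  obtain ⟨x, hx⟩ := hborder
  refine ⟨fun F hF => ?_, iInf₂_le_of_le _ (main x hx).1 (main x hx).2, main⟩
  obtain ⟨g, hg, rfl, hfg⟩ := hF
  have hrange : Set.range g = {g 0, g 1} := by
    ext h
    simp [Fin.exists_fin_two, eq_comm]
  rw [hrange]
  rcases eq_and_eq_or_of_agree_conj hdef h₁' h₂' hx (hg 0) (hg 1)
    (fun y _ => by rw [hfg, Fin.forall_fin_two]) with ⟨e, e'⟩ | ⟨e, e'⟩
  · rw [e, e']
  · rw [e, e', Set.pair_comm]
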